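/- A monad $\mathbb{S} = (S,\eta^S,\mu^S)$ on the category $\mathbf{Set}$ of sets is called consistent when its unit component $\eta^S_X\colon X \to SX$ is injective for every set $X$. A monad morphism is called injective when all its components are injective functions. The coproduct $\mathbb{S}\oplus\mathbb{T}$ of two monads is their coproduct in the category of monads on $\mathbf{Set}$ and monad morphisms (it need not exist). Let $\mathbb{S}',\mathbb{T}'$ be consistent monads on $\mathbf{Set}$ such that the coproduct $\mathbb{S}'\oplus\mathbb{T}'$ exists, let $\mathbb{S},\mathbb{T}$ be monads on $\mathbf{Set}$, and let $i\colon \mathbb{S}\to\mathbb{S}'$ and $j\colon \mathbb{T}\to\mathbb{T}'$ be injective monad morphisms. Then - the coproduct $\mathbb{S}\oplus\mathbb{T}$ exists, and - the induced monad morphism $i\oplus j\colon \mathbb{S}\oplus\mathbb{T}\to\mathbb{S}'\oplus\mathbb{T}'$ is injective. -/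

import Mathlib

open CategoryTheory Limits

universe u

/-- A monad on the category of sets is consistent when every component of its unit is injective. -/
def CategoryTheory.Monad.IsConsistent (S : Monad (Type u)) : Prop :=
  ∀ X : Type u, Function.Injective (S.η.app X)

/-- A morphism of monads on the category of sets is injective when all its components are. -/
def CategoryTheory.MonadHom.IsInjective {S T : Monad (Type u)} (i : S ⟶ T) : Prop :=
  ∀ X : Type u, Function.Injective (i.app X)

/-! If every set carries a free bialgebra (an `S`-algebra and a `T`-algebra on one carrier), the
free bialgebras form the coproduct monad. The candidate over `X` is the subset of `(S' ⨿ T').obj X`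
generated from the units by the `S`- and `T`-operations. Generation gives uniqueness of
homomorphisms out of it, and the comparison with `S' ⨿ T'` is an inclusion, hence injective.

Existence of homomorphisms into an arbitrary bialgebra `B` rests on `exists_resolution`: `B` is a
quotient of some `D` embedded in an `S'`-`T'`-bialgebra `E`. A map `X ⟶ B` lifts through `D` into
`E`, extends to `(S' ⨿ T').obj X` (`exists_isHom_coprod`), carries the generated subset into `D`,
and then descends to `B`.

To build `D`, each monad is treated separately. Padding by large powers makes every fibre of `D`
over `B` and the complement of `D` in `E` have one prescribed cardinality. The carriers then become
`B × K` and `(B × K) ⊕ K` for both monads, so the structures can be superposed. -/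

namespace CategoryTheory

universe v w

variable {C : Type w} [Category.{v} C]

/-! ### Monad and algebra identities in a general category -/

namespace Monad

/-- The unit of a monad, with the identity functor unfolded. -/
def unit (S : Monad C) (X : C) : X ⟶ S.obj X := S.η.app X

/-- The multiplication of a monad, with the composite functor unfolded. -/
def mul (S : Monad C) (X : C) : S.obj (S.obj X) ⟶ S.obj X := S.μ.app X

variable (S : Monad C)

theorem unit_map {X Y : C} (f : X ⟶ Y) : S.unit X ≫ S.map f = f ≫ S.unit Y :=
  (S.η.naturality f).symm

theorem unit_map_assoc {X Y Z : C} (f : X ⟶ Y) (h : S.obj Y ⟶ Z) :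
    S.unit X ≫ S.map f ≫ h = f ≫ S.unit Y ≫ h := by
  rw [← Category.assoc, unit_map, Category.assoc]

theorem mul_map {X Y : C} (f : X ⟶ Y) : S.mul X ≫ S.map f = S.map (S.map f) ≫ S.mul Y :=
  (S.μ.naturality f).symm

theorem mul_map_assoc {X Y Z : C} (f : X ⟶ Y) (h : S.obj Y ⟶ Z) :
    S.mul X ≫ S.map f ≫ h = S.map (S.map f) ≫ S.mul Y ≫ h := by
  rw [← Category.assoc, mul_map, Category.assoc]

theorem map_mul_mul (X : C) : S.map (S.mul X) ≫ S.mul X = S.mul (S.obj X) ≫ S.mul X :=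
  S.assoc X

theorem unit_mul (X : C) : S.unit (S.obj X) ≫ S.mul X = 𝟙 _ := S.left_unit X

theorem map_unit_mul (X : C) : S.map (S.unit X) ≫ S.mul X = 𝟙 _ := S.right_unit X

end Monad

namespace MonadHom

variable {S S' : Monad C} (i : S ⟶ S')

theorem map_app {X Y : C} (f : X ⟶ Y) : S.map f ≫ i.app Y = i.app X ≫ S'.map f :=
  i.naturality f

theorem map_app_assoc {X Y Z : C} (f : X ⟶ Y) (h : S'.obj Y ⟶ Z) :
    S.map f ≫ i.app Y ≫ h = i.app X ≫ S'.map f ≫ h := by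
  rw [← Category.assoc, map_app, Category.assoc]

theorem unit_app (X : C) : S.unit X ≫ i.app X = S'.unit X := i.app_η X

theorem unit_app_assoc {X Z : C} (h : S'.obj X ⟶ Z) :
    S.unit X ≫ i.app X ≫ h = S'.unit X ≫ h := by
  rw [← Category.assoc, unit_app]

theorem mul_app (X : C) :
    S.mul X ≫ i.app X = S.map (i.app X) ≫ i.app (S'.obj X) ≫ S'.mul X :=
  (i.app_μ X).trans (Category.assoc _ _ _)

theorem mul_app_assoc {X Z : C} (h : S'.obj X ⟶ Z) :
    S.mul X ≫ i.app X ≫ h = S.map (i.app X) ≫ i.app (S'.obj X) ≫ S'.mul X ≫ h := by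
  rw [← Category.assoc, mul_app, Category.assoc, Category.assoc]

end MonadHom

/-- The Eilenberg–Moore laws for a morphism `S A ⟶ A`. -/
structure Monad.IsAlgebra (S : Monad C) {A : C} (a : S.obj A ⟶ A) : Prop where
  unit : S.unit A ≫ a = 𝟙 A
  mul : S.mul A ≫ a = S.map a ≫ a

theorem Monad.IsAlgebra.unit_assoc {S : Monad C} {A Z : C} {a : S.obj A ⟶ A}
    (ha : S.IsAlgebra a) (h : A ⟶ Z) : S.unit A ≫ a ≫ h = h := by
  rw [← Category.assoc, ha.unit, Category.id_comp]

theorem Monad.IsAlgebra.mul_assoc {S : Monad C} {A Z : C} {a : S.obj A ⟶ A}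
    (ha : S.IsAlgebra a) (h : A ⟶ Z) : S.mul A ≫ a ≫ h = S.map a ≫ a ≫ h := by
  rw [← Category.assoc, ha.mul, Category.assoc]

theorem Monad.isAlgebra_mul (S : Monad C) (X : C) : S.IsAlgebra (S.mul X) :=
  ⟨S.unit_mul X, (S.map_mul_mul X).symm⟩

theorem Monad.IsAlgebra.transport {S : Monad C} {A B : C} {a : S.obj A ⟶ A}
    (ha : S.IsAlgebra a) (e : A ≅ B) : S.IsAlgebra (S.map e.inv ≫ a ≫ e.hom) where
  unit := by
    rw [S.unit_map_assoc, ha.unit_assoc, e.inv_hom_id]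
  mul := by
    rw [S.mul_map_assoc, ha.mul_assoc, ← Functor.map_comp_assoc, ← Functor.map_comp_assoc]
    simp

theorem MonadHom.isAlgebra_restrict {S S' : Monad C} (i : S ⟶ S') {A : C} {a : S'.obj A ⟶ A}
    (ha : S'.IsAlgebra a) : S.IsAlgebra (i.app A ≫ a) where
  unit := by rw [MonadHom.unit_app_assoc, ha.unit]
  mul := by
    rw [MonadHom.mul_app_assoc, ha.mul, Functor.map_comp, Category.assoc,
      MonadHom.map_app_assoc i a]

/-- The algebra structure on `Q X` induced by a monad morphism `S ⟶ Q`. -/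
def MonadHom.action {S Q : Monad C} (s : S ⟶ Q) (X : C) : S.obj (Q.obj X) ⟶ Q.obj X :=
  s.app (Q.obj X) ≫ Q.mul X

namespace MonadHom

variable {S Q R : Monad C} (s : S ⟶ Q)

theorem isAlgebra_action (X : C) : S.IsAlgebra (action s X) :=
  isAlgebra_restrict s (Q.isAlgebra_mul X)

theorem map_map_action {X Y : C} (f : X ⟶ Y) :
    S.map (Q.map f) ≫ action s Y = action s X ≫ Q.map f := by
  rw [action, action, map_app_assoc, Category.assoc, Q.mul_map]

theorem map_mul_action (X : C) :
    S.map (Q.mul X) ≫ action s X = action s (Q.obj X) ≫ Q.mul X := by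
  rw [action, action, map_app_assoc, Category.assoc, Q.map_mul_mul]

theorem map_unit_action (X : C) : S.map (Q.unit X) ≫ action s X = s.app X := by
  rw [action, map_app_assoc, Q.map_unit_mul, Category.comp_id]

theorem map_app_action (φ : Q ⟶ R) (X : C) :
    S.map (φ.app X) ≫ action (s ≫ φ) X = action s X ≫ φ.app X := by
  have e : (s ≫ φ).app (R.obj X) = s.app (R.obj X) ≫ φ.app (R.obj X) := rfl
  rw [action, action, e, Category.assoc, Category.assoc, mul_app, map_app_assoc]

end MonadHom

/-! ### Bialgebras for a pair of monads -/

/-- Algebra structures for two monads on the same object. -/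
structure Bialgebra (S T : Monad C) (A : C) where
  left : S.obj A ⟶ A
  right : T.obj A ⟶ A
  isAlgebra_left : S.IsAlgebra left
  isAlgebra_right : T.IsAlgebra right

namespace Bialgebra

variable {S T : Monad C}

/-- A morphism of carriers which preserves both algebra structures. -/
structure IsHom {A B : C} (a : Bialgebra S T A) (b : Bialgebra S T B) (f : A ⟶ B) : Prop where
  left : S.map f ≫ b.left = a.left ≫ f
  right : T.map f ≫ b.right = a.right ≫ f

theorem IsHom.id {A : C} (a : Bialgebra S T A) : IsHom a a (𝟙 A) := ⟨by simp, by simp⟩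

theorem IsHom.comp {A B D : C} {a : Bialgebra S T A} {b : Bialgebra S T B}
    {d : Bialgebra S T D} {f : A ⟶ B} {g : B ⟶ D}
    (hf : IsHom a b f) (hg : IsHom b d g) : IsHom a d (f ≫ g) :=
  ⟨by rw [Functor.map_comp, Category.assoc, hg.left, reassoc_of% hf.left],
   by rw [Functor.map_comp, Category.assoc, hg.right, reassoc_of% hf.right]⟩

/-- The bialgebra on `Q X` induced by a cospan of monads. -/
@[simps]
def ofCospan {Q : Monad C} (s : S ⟶ Q) (t : T ⟶ Q) (X : C) : Bialgebra S T (Q.obj X) where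
  left := MonadHom.action s X
  right := MonadHom.action t X
  isAlgebra_left := MonadHom.isAlgebra_action s X
  isAlgebra_right := MonadHom.isAlgebra_action t X

theorem isHom_map {Q : Monad C} (s : S ⟶ Q) (t : T ⟶ Q) {X Y : C} (f : X ⟶ Y) :
    IsHom (ofCospan s t X) (ofCospan s t Y) (Q.map f) :=
  ⟨MonadHom.map_map_action s f, MonadHom.map_map_action t f⟩

theorem isHom_mul {Q : Monad C} (s : S ⟶ Q) (t : T ⟶ Q) (X : C) :
    IsHom (ofCospan s t (Q.obj X)) (ofCospan s t X) (Q.mul X) :=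
  ⟨MonadHom.map_mul_action s X, MonadHom.map_mul_action t X⟩

theorem isHom_app {Q R : Monad C} (s : S ⟶ Q) (t : T ⟶ Q) (φ : Q ⟶ R) (X : C) :
    IsHom (ofCospan s t X) (ofCospan (s ≫ φ) (t ≫ φ) X) (φ.app X) :=
  ⟨MonadHom.map_app_action s φ X, MonadHom.map_app_action t φ X⟩

/-- The restriction of a bialgebra along two monad morphisms. -/
@[simps]
def restrict {S' T' : Monad C} (i : S ⟶ S') (j : T ⟶ T') {A : C} (a : Bialgebra S' T' A) :
    Bialgebra S T A where
  left := i.app A ≫ a.left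
  right := j.app A ≫ a.right
  isAlgebra_left := MonadHom.isAlgebra_restrict i a.isAlgebra_left
  isAlgebra_right := MonadHom.isAlgebra_restrict j a.isAlgebra_right

theorem IsHom.restrict {S' T' : Monad C} (i : S ⟶ S') (j : T ⟶ T') {A B : C}
    {a : Bialgebra S' T' A} {b : Bialgebra S' T' B} {f : A ⟶ B} (hf : IsHom a b f) :
    IsHom (a.restrict i j) (b.restrict i j) f where
  left := by
    rw [restrict_left, restrict_left, MonadHom.map_app_assoc, hf.left, Category.assoc]
  right := by
    rw [restrict_right, restrict_right, MonadHom.map_app_assoc, hf.right, Category.assoc]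

end Bialgebra

/-! ### Free bialgebras give the coproduct of monads -/

/-- A choice of free bialgebras on all objects. -/
structure FreeBialgebras (S T : Monad C) where
  obj : C → C
  str (X : C) : Bialgebra S T (obj X)
  unit (X : C) : X ⟶ obj X
  lift {X A : C} (a : Bialgebra S T A) (f : X ⟶ A) : obj X ⟶ A
  isHom_lift {X A : C} (a : Bialgebra S T A) (f : X ⟶ A) : (str X).IsHom a (lift a f)
  unit_lift {X A : C} (a : Bialgebra S T A) (f : X ⟶ A) : unit X ≫ lift a f = f
  hom_ext {X A : C} {a : Bialgebra S T A} {f g : obj X ⟶ A} :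
    (str X).IsHom a f → (str X).IsHom a g → unit X ≫ f = unit X ≫ g → f = g

namespace FreeBialgebras

variable {S T : Monad C} (F : FreeBialgebras S T)

theorem lift_comp {X A B : C} {a : Bialgebra S T A} {b : Bialgebra S T B} (f : X ⟶ A) {g : A ⟶ B}
    (hg : a.IsHom b g) : F.lift a f ≫ g = F.lift b (f ≫ g) :=
  F.hom_ext ((F.isHom_lift a f).comp hg) (F.isHom_lift _ _) (by
    rw [reassoc_of% F.unit_lift a f, F.unit_lift])

theorem lift_unit (X : C) : F.lift (F.str X) (F.unit X) = 𝟙 _ :=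
  F.hom_ext (F.isHom_lift _ _) (.id _) (by rw [F.unit_lift, Category.comp_id])

theorem lift_id_comp {X A : C} {a : Bialgebra S T A} {f : F.obj X ⟶ A}
    (hf : (F.str X).IsHom a f) : F.lift (F.str X) (𝟙 _) ≫ f = F.lift a f := by
  rw [F.lift_comp _ hf, Category.id_comp]

theorem lift_unit_comp_lift {X Y A : C} (f : X ⟶ Y) (a : Bialgebra S T A) (g : Y ⟶ A) :
    F.lift (F.str Y) (f ≫ F.unit Y) ≫ F.lift a g = F.lift a (f ≫ g) := by
  rw [F.lift_comp _ (F.isHom_lift _ _), Category.assoc, F.unit_lift]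

/-- The monad of free bialgebras. -/
def monad : Monad C where
  obj X := F.obj X
  map {X Y} f := F.lift (F.str Y) (f ≫ F.unit Y)
  map_id X := by rw [Category.id_comp, lift_unit]
  map_comp {X Y Z} f g := by rw [F.lift_unit_comp_lift, Category.assoc]
  η := { app := F.unit, naturality := fun X Y f => (F.unit_lift _ _).symm }
  μ :=
    { app X := F.lift (F.str X) (𝟙 _)
      naturality := fun X Y f =>
        ((F.lift_unit_comp_lift _ _ _).trans (congrArg (F.lift _) (Category.comp_id _))).trans
          (F.lift_id_comp (F.isHom_lift _ _)).symm }
  assoc X :=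
    ((F.lift_unit_comp_lift _ _ _).trans (congrArg (F.lift _) (Category.comp_id _))).trans
      (F.lift_id_comp (F.isHom_lift _ _)).symm
  left_unit X := F.unit_lift _ _
  right_unit X :=
    ((F.lift_unit_comp_lift _ _ _).trans (congrArg (F.lift _) (Category.comp_id _))).trans
      (F.lift_unit X)

/-- Stated for one abstract monad `M` with actions `l`, so that both coprojections can use it. -/
theorem coprojection_naturality {M : Monad C} {X Y : C} (l : ∀ X, M.obj (F.obj X) ⟶ F.obj X)
    {f : X ⟶ Y} {g : F.obj X ⟶ F.obj Y} (hg : F.unit X ≫ g = f ≫ F.unit Y)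
    (hl : M.map g ≫ l Y = l X ≫ g) :
    M.map f ≫ M.map (F.unit Y) ≫ l Y = (M.map (F.unit X) ≫ l X) ≫ g := by
  rw [Category.assoc, ← hl, ← Functor.map_comp_assoc, ← Functor.map_comp_assoc, hg]

theorem map_unit_comp {M : Monad C} {X A : C} {l : M.obj (F.obj X) ⟶ F.obj X}
    {a : M.obj A ⟶ A} {g : F.obj X ⟶ A} {f : X ⟶ A} (hg : F.unit X ≫ g = f)
    (hl : M.map g ≫ a = l ≫ g) : (M.map (F.unit X) ≫ l) ≫ g = M.map f ≫ a := by
  rw [Category.assoc, ← hl, ← Functor.map_comp_assoc, hg]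

theorem coprojection_unit {M : Monad C} {X : C} {l : M.obj (F.obj X) ⟶ F.obj X}
    (hl : M.IsAlgebra l) : M.unit X ≫ M.map (F.unit X) ≫ l = F.unit X := by
  rw [M.unit_map_assoc, hl.unit, Category.comp_id]

theorem coprojection_mul {M : Monad C} {X : C} {l : ∀ X, M.obj (F.obj X) ⟶ F.obj X}
    {m : F.obj (F.obj X) ⟶ F.obj X}
    (hl : M.IsAlgebra (l X)) (hm : F.unit (F.obj X) ≫ m = 𝟙 _)
    (hml : M.map m ≫ l X = l (F.obj X) ≫ m) :
    M.mul X ≫ M.map (F.unit X) ≫ l X =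
      (M.map (M.map (F.unit X) ≫ l X) ≫ M.map (F.unit (F.obj X)) ≫ l (F.obj X)) ≫ m := by
  rw [Category.assoc, F.map_unit_comp hm hml, M.mul_map_assoc, hl.mul]
  simp

/-- The left coprojection into the monad of free bialgebras. -/
def inl : S ⟶ F.monad where
  app X := S.map (F.unit X) ≫ (F.str X).left
  naturality _ Y f := F.coprojection_naturality (M := S) (fun X => (F.str X).left)
    (F.unit_lift _ _) (F.isHom_lift (F.str Y) (f ≫ F.unit Y)).left
  app_η X := F.coprojection_unit (F.str X).isAlgebra_left
  app_μ X := F.coprojection_mul (l := fun X => (F.str X).left) (F.str X).isAlgebra_left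
    (F.unit_lift _ _) (F.isHom_lift (F.str X) (𝟙 _)).left

/-- The right coprojection into the monad of free bialgebras. -/
def inr : T ⟶ F.monad where
  app X := T.map (F.unit X) ≫ (F.str X).right
  naturality _ Y f := F.coprojection_naturality (M := T) (fun X => (F.str X).right)
    (F.unit_lift _ _) (F.isHom_lift (F.str Y) (f ≫ F.unit Y)).right
  app_η X := F.coprojection_unit (F.str X).isAlgebra_right
  app_μ X := F.coprojection_mul (l := fun X => (F.str X).right) (F.str X).isAlgebra_right
    (F.unit_lift _ _) (F.isHom_lift (F.str X) (𝟙 _)).right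

/-- Needed for `desc_unique`: it makes components of monad morphisms out of `F.monad` homomorphisms
for `F.str`. -/
theorem action_inl (X : C) : MonadHom.action F.inl X = (F.str X).left :=
  (F.map_unit_comp (F.unit_lift (F.str X) (𝟙 _)) (F.isHom_lift (F.str X) (𝟙 _)).left).trans
    (by simp)

theorem action_inr (X : C) : MonadHom.action F.inr X = (F.str X).right :=
  (F.map_unit_comp (F.unit_lift (F.str X) (𝟙 _)) (F.isHom_lift (F.str X) (𝟙 _)).right).trans
    (by simp)

variable {Q : Monad C} (s : S ⟶ Q) (t : T ⟶ Q)

theorem lift_map_desc {X Y : C} (f : X ⟶ Y) :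
    F.lift (F.str Y) (f ≫ F.unit Y) ≫ F.lift (.ofCospan s t Y) (Q.unit Y) =
      F.lift (.ofCospan s t X) (Q.unit X) ≫ Q.map f := by
  rw [F.lift_unit_comp_lift, F.lift_comp _ (Bialgebra.isHom_map s t f), Q.unit_map]

theorem lift_mul_desc (X : C) :
    F.lift (F.str X) (𝟙 _) ≫ F.lift (.ofCospan s t X) (Q.unit X) =
      (F.lift (F.str (Q.obj X)) (F.lift (.ofCospan s t X) (Q.unit X) ≫ F.unit (Q.obj X)) ≫
        F.lift (.ofCospan s t (Q.obj X)) (Q.unit (Q.obj X))) ≫ Q.mul X := by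
  rw [F.lift_id_comp (F.isHom_lift _ _), F.lift_unit_comp_lift,
    F.lift_comp _ (Bialgebra.isHom_mul s t X), Category.assoc, Q.unit_mul, Category.comp_id]

/-- The monad morphism out of the monad of free bialgebras induced by a cospan. -/
def desc : F.monad ⟶ Q where
  app X := F.lift (.ofCospan s t X) (Q.unit X)
  naturality _ _ f := F.lift_map_desc s t f
  app_η _ := F.unit_lift _ _
  app_μ X := F.lift_mul_desc s t X

theorem inl_desc : F.inl ≫ F.desc s t = s := by
  apply MonadHom.ext'
  funext X
  exact (F.map_unit_comp (F.unit_lift _ _)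
    (F.isHom_lift (Bialgebra.ofCospan s t X) (Q.unit X)).left).trans (MonadHom.map_unit_action s X)

theorem inr_desc : F.inr ≫ F.desc s t = t := by
  apply MonadHom.ext'
  funext X
  exact (F.map_unit_comp (F.unit_lift _ _)
    (F.isHom_lift (Bialgebra.ofCospan s t X) (Q.unit X)).right).trans
      (MonadHom.map_unit_action t X)

variable {s t} in
theorem desc_unique {φ : F.monad ⟶ Q}
    (hs : F.inl ≫ φ = s) (ht : F.inr ≫ φ = t) : φ = F.desc s t := by
  subst hs ht
  apply MonadHom.ext'
  funext X
  have h := Bialgebra.isHom_app F.inl F.inr φ X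
  refine F.hom_ext (a := Bialgebra.ofCospan (F.inl ≫ φ) (F.inr ≫ φ) X) ⟨?_, ?_⟩
    (F.isHom_lift _ _) ?_
  · rw [← F.action_inl]; exact h.left
  · rw [← F.action_inr]; exact h.right
  · exact (φ.app_η X).trans (F.unit_lift _ _).symm

/-- The monad of free bialgebras is the coproduct of the two monads. -/
def isColimit : IsColimit (BinaryCofan.mk F.inl F.inr) :=
  BinaryCofan.isColimitMk (fun s => F.desc s.inl s.inr) (fun _ => F.inl_desc _ _)
    (fun _ => F.inr_desc _ _) (fun _ _ hs ht => F.desc_unique hs ht)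

theorem hasBinaryCoproduct (F : FreeBialgebras S T) : HasBinaryCoproduct S T := ⟨⟨⟨_, F.isColimit⟩⟩⟩

end FreeBialgebras

end CategoryTheory

/-! ### Algebras as monad morphisms into continuation monads -/

namespace CategoryTheory

theorem Monad.IsAlgebra.of_jointly_monic {C : Type w} [Category.{v} C] {S : Monad C} {P : C}
    {ι : Type*} {A : ι → C} {a : ∀ k, S.obj (A k) ⟶ A k} (ha : ∀ k, S.IsAlgebra (a k))
    {π : ∀ k, P ⟶ A k} (hπ : ∀ {Z : C} (f g : Z ⟶ P), (∀ k, f ≫ π k = g ≫ π k) → f = g)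
    {p : S.obj P ⟶ P} (hp : ∀ k, S.map (π k) ≫ a k = p ≫ π k) : S.IsAlgebra p where
  unit := hπ _ _ fun k => by
    rw [Category.assoc, ← hp, S.unit_map_assoc, (ha k).unit, Category.comp_id, Category.id_comp]
  mul := hπ _ _ fun k => by
    rw [Category.assoc, ← hp, S.mul_map_assoc, (ha k).mul, Category.assoc, ← hp,
      ← Functor.map_comp_assoc, hp, Functor.map_comp, Category.assoc, hp]

namespace Monad

variable {S : Monad (Type u)}

theorem IsAlgebra.of_injective {A B : Type u} {b : S.obj B ⟶ B} (hb : S.IsAlgebra b)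
    {m : A ⟶ B} (hm : Function.Injective m) {a : S.obj A ⟶ A}
    (h : S.map m ≫ b = a ≫ m) : S.IsAlgebra a :=
  .of_jointly_monic (ι := Unit) (fun _ => hb) (π := fun _ => m)
    (fun f g hfg => by
      ext z
      exact hm (ConcreteCategory.congr_hom (hfg ()) z)) fun _ => h

/-- The continuation monad with answers in a fixed type. -/
def continuation (A : Type u) : Monad (Type u) where
  obj X := (X → A) → A
  map f := ↾fun φ k => φ fun x => k (f x)
  η := { app X := ↾fun x k => k x }
  μ := { app X := ↾fun Φ k => Φ fun φ => φ k }

/-- The monad morphism to the continuation monad given by an algebra. -/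
def IsAlgebra.toContinuation {A : Type u} {a : S.obj A ⟶ A} (ha : S.IsAlgebra a) :
    S ⟶ continuation A where
  app X := ↾fun s k => a (S.map (↾k) s)
  naturality X Y f := by
    ext s
    funext k
    change a (S.map (↾k) (S.map f s)) = a (S.map (↾fun x => k (f x)) s)
    rw [← Functor.map_comp_apply]
    rfl
  app_η X := by
    ext x
    funext k
    have h := ConcreteCategory.congr_hom (S.unit_map_assoc (↾k) a) x
    rw [ha.unit] at h
    exact h
  app_μ X := by
    ext s
    funext k
    have h := ConcreteCategory.congr_hom (S.mul_map_assoc (↾k) a) s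
    rw [ha.mul, ← Functor.map_comp_assoc] at h
    refine h.trans ?_
    change _ = a (S.map _ (S.map _ s))
    rw [← Functor.map_comp_apply]
    rfl

/-- A monad morphism to the continuation monad extends maps along the unit. -/
def extend {P : Monad (Type u)} {A : Type u} (θ : P ⟶ continuation A) {X : Type u}
    (f : X ⟶ A) : P.obj X ⟶ A :=
  ↾fun p => θ.app X p f

theorem unit_extend {P : Monad (Type u)} {A : Type u} (θ : P ⟶ continuation A) {X : Type u}
    (f : X ⟶ A) : P.unit X ≫ extend θ f = f := by
  ext x
  exact congrFun (ConcreteCategory.congr_hom (MonadHom.unit_app θ X) x) f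

/-- Compatibility of `θ` with multiplication, evaluated at `f`, and naturality of `θ` reduce the
claim to the value of `s ≫ θ`, which `h` identifies with `a`. -/
theorem map_extend {P : Monad (Type u)} {A : Type u} {a : S.obj A ⟶ A} (ha : S.IsAlgebra a)
    {s : S ⟶ P} {θ : P ⟶ continuation A} (h : s ≫ θ = ha.toContinuation) {X : Type u}
    (f : X ⟶ A) : S.map (extend θ f) ≫ a = MonadHom.action s X ≫ extend θ f := by
  ext x
  have h₁ := congrFun (ConcreteCategory.congr_hom (MonadHom.mul_app θ X)
    (s.app (P.obj X) x)) f
  have h₂ := congrFun (ConcreteCategory.congr_hom (MonadHom.map_app θ (θ.app X))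
    (s.app (P.obj X) x)) fun φ => φ f
  have h₃ : (s ≫ θ).app (P.obj X) x (extend θ f) = a (S.map (extend θ f) x) := by
    rw [h]; rfl
  exact (h₃.symm.trans h₂.symm).trans h₁.symm

end Monad

/-! ### Closed subsets and generated sub-bialgebras -/

namespace Bialgebra

open CategoryTheory.Monad

variable {S T : Monad (Type u)}

/-- The universal property of `S ⨿ T` concerns monads only; it reaches bialgebras because the two
structures on `A` are morphisms into the same `continuation A` and can be copaired. -/
theorem exists_isHom_coprod [HasBinaryCoproduct S T] {A : Type u} (a : Bialgebra S T A)
    {X : Type u} (f : X ⟶ A) :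
    ∃ h : (S ⨿ T).obj X ⟶ A,
      (ofCospan coprod.inl coprod.inr X).IsHom a h ∧ (S ⨿ T).unit X ≫ h = f :=
  ⟨extend (coprod.desc a.isAlgebra_left.toContinuation a.isAlgebra_right.toContinuation) f,
    ⟨map_extend a.isAlgebra_left (coprod.inl_desc _ _) f,
      map_extend a.isAlgebra_right (coprod.inr_desc _ _) f⟩, unit_extend _ f⟩

/-- A subset closed under both algebra structures. -/
structure IsClosed {A : Type u} (a : Bialgebra S T A) (Z : Set A) : Prop where
  left (s : S.obj Z) : a.left (S.map (↾(Subtype.val : Z → A)) s) ∈ Z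
  right (s : T.obj Z) : a.right (T.map (↾(Subtype.val : Z → A)) s) ∈ Z

variable {A B D : Type u} {a : Bialgebra S T A} {b : Bialgebra S T B} {d : Bialgebra S T D}

/-- By choice `f` factors through `g`, and functors preserve factorizations. -/
theorem _root_.CategoryTheory.Functor.exists_map_eq (F : Type u ⥤ Type u) {X Y Z : Type u}
    {f : X ⟶ Z} {g : Y ⟶ Z} (h : ∀ x, ∃ y, g y = f x) (s : F.obj X) :
    ∃ t : F.obj Y, F.map g t = F.map f s := by
  choose k hk using h
  refine ⟨F.map (↾k) s, ?_⟩
  rw [← Functor.map_comp_apply]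
  have e : ↾k ≫ g = f := by
    ext x
    exact hk x
  rw [e]

theorem IsClosed.sInter {𝒵 : Set (Set A)} (h : ∀ Z ∈ 𝒵, a.IsClosed Z) : a.IsClosed (⋂₀ 𝒵) where
  left s Z hZ := by
    obtain ⟨t, ht⟩ := S.toFunctor.exists_map_eq (f := ↾(Subtype.val : ↥(⋂₀ 𝒵) → A))
      (g := ↾(Subtype.val : Z → A)) (fun x => ⟨⟨x.1, x.2 Z hZ⟩, rfl⟩) s
    rw [← ht]
    exact (h Z hZ).left t
  right s Z hZ := by
    obtain ⟨t, ht⟩ := T.toFunctor.exists_map_eq (f := ↾(Subtype.val : ↥(⋂₀ 𝒵) → A))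
      (g := ↾(Subtype.val : Z → A)) (fun x => ⟨⟨x.1, x.2 Z hZ⟩, rfl⟩) s
    rw [← ht]
    exact (h Z hZ).right t

theorem IsHom.isClosed_preimage_range {f : A ⟶ B} (hf : a.IsHom b f) {e : D ⟶ B}
    (he : d.IsHom b e) : a.IsClosed {x | ∃ y, e y = f x} where
  left s := by
    obtain ⟨t, ht⟩ := S.toFunctor.exists_map_eq
      (f := ↾(Subtype.val : {x | ∃ y, e y = f x} → A) ≫ f) (g := e) (fun x => x.2) s
    refine ⟨d.left t, ?_⟩
    rw [← types_comp_apply, ← he.left, ← types_comp_apply _ f, ← hf.left, types_comp_apply, ht,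
      Functor.map_comp_apply]
    rfl
  right s := by
    obtain ⟨t, ht⟩ := T.toFunctor.exists_map_eq
      (f := ↾(Subtype.val : {x | ∃ y, e y = f x} → A) ≫ f) (g := e) (fun x => x.2) s
    refine ⟨d.right t, ?_⟩
    rw [← types_comp_apply, ← he.right, ← types_comp_apply _ f, ← hf.right, types_comp_apply, ht,
      Functor.map_comp_apply]
    rfl

theorem IsHom.eq_of_injective {f : A ⟶ D} {e : D ⟶ B} (he : d.IsHom b e)
    (hinj : Function.Injective e) (hf : a.IsHom b (f ≫ e)) : a.IsHom d f where
  left := by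
    ext x
    apply hinj
    have h := ConcreteCategory.congr_hom hf.left x
    rw [Functor.map_comp, Category.assoc, he.left] at h
    exact h
  right := by
    ext x
    apply hinj
    have h := ConcreteCategory.congr_hom hf.right x
    rw [Functor.map_comp, Category.assoc, he.right] at h
    exact h

theorem IsHom.isClosed_eq {f g : A ⟶ B} (hf : a.IsHom b f) (hg : a.IsHom b g) :
    a.IsClosed {x | f x = g x} := by
  have key : ↾(Subtype.val : {x | f x = g x} → A) ≫ f = ↾Subtype.val ≫ g := by
    ext x
    exact x.2
  constructor
  · intro s
    change f _ = g _
    rw [← types_comp_apply _ f, ← types_comp_apply _ g, ← hf.left, ← hg.left, types_comp_apply,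
      types_comp_apply, ← Functor.map_comp_apply, ← Functor.map_comp_apply, key]
  · intro s
    change f _ = g _
    rw [← types_comp_apply _ f, ← types_comp_apply _ g, ← hf.right, ← hg.right, types_comp_apply,
      types_comp_apply, ← Functor.map_comp_apply, ← Functor.map_comp_apply, key]

/-- The bialgebra structure on a closed subset. -/
def sub {Z : Set A} (hZ : a.IsClosed Z) : Bialgebra S T Z where
  left := ↾fun s => ⟨_, hZ.left s⟩
  right := ↾fun s => ⟨_, hZ.right s⟩
  isAlgebra_left := a.isAlgebra_left.of_injective (m := ↾Subtype.val) Subtype.val_injective rfl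
  isAlgebra_right := a.isAlgebra_right.of_injective (m := ↾Subtype.val) Subtype.val_injective rfl

theorem isHom_val {Z : Set A} (hZ : a.IsClosed Z) : (sub hZ).IsHom a (↾Subtype.val) := ⟨rfl, rfl⟩

variable (a) in
/-- The smallest closed subset containing the range of a map. -/
def generated {X : Type u} (f : X ⟶ A) : Set A := ⋂₀ {Z | (∀ x, f x ∈ Z) ∧ a.IsClosed Z}

theorem isClosed_generated {X : Type u} (f : X ⟶ A) : a.IsClosed (a.generated f) :=
  .sInter fun _ hZ => hZ.2

theorem mem_generated {X : Type u} (f : X ⟶ A) (x : X) : f x ∈ a.generated f :=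
  fun _ hZ => hZ.1 x

theorem generated_subset {X : Type u} {f : X ⟶ A} {Z : Set A} (hf : ∀ x, f x ∈ Z)
    (hZ : a.IsClosed Z) : a.generated f ⊆ Z :=
  fun _ hx => hx Z ⟨hf, hZ⟩

theorem IsClosed.image_val {Y : Set A} (hY : a.IsClosed Y) {Z : Set Y}
    (hZ : (sub hY).IsClosed Z) : a.IsClosed (Subtype.val '' Z) where
  left s := by
    obtain ⟨t, ht⟩ := S.toFunctor.exists_map_eq
      (f := ↾(Subtype.val : ↥(Subtype.val '' Z) → A))
      (g := ↾(Subtype.val : Z → Y) ≫ ↾Subtype.val)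
      (fun ⟨_, y, hy, h⟩ => ⟨⟨y, hy⟩, h⟩) s
    refine ⟨_, hZ.left t, ?_⟩
    rw [← ht, Functor.map_comp_apply]
    rfl
  right s := by
    obtain ⟨t, ht⟩ := T.toFunctor.exists_map_eq
      (f := ↾(Subtype.val : ↥(Subtype.val '' Z) → A))
      (g := ↾(Subtype.val : Z → Y) ≫ ↾Subtype.val)
      (fun ⟨_, y, hy, h⟩ => ⟨⟨y, hy⟩, h⟩) s
    refine ⟨_, hZ.right t, ?_⟩
    rw [← ht, Functor.map_comp_apply]
    rfl

/-- The equalizer is closed and contains the generators, so it is everything. -/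
theorem generated_hom_ext {X : Type u} {f : X ⟶ A} {g h : ↥(a.generated f) ⟶ B}
    (hg : (sub (isClosed_generated f)).IsHom b g) (hh : (sub (isClosed_generated f)).IsHom b h)
    (e : ∀ x, g ⟨f x, mem_generated f x⟩ = h ⟨f x, mem_generated f x⟩) : g = h := by
  ext x
  have hf : ∀ x, f x ∈ (Subtype.val '' {x : ↥(a.generated f) | g x = h x} : Set A) :=
    fun x => ⟨⟨f x, mem_generated f x⟩, e x, rfl⟩
  obtain ⟨y, hy, hyx⟩ := generated_subset hf
      ((isClosed_generated f).image_val (hg.isClosed_eq hh)) x.2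
  rwa [← Subtype.ext hyx]

/-- The preimage under `f` of the range of `e` is closed and contains the generators; injectivity of
`e` makes the resulting factorization a homomorphism. -/
theorem exists_lift_generated {X E : Type u} {u : X ⟶ A} {f : A ⟶ E} {c : Bialgebra S T E}
    (hf : a.IsHom c f) {e : D ⟶ E} (he : d.IsHom c e) (hinj : Function.Injective e)
    {k : X ⟶ D} (hk : u ≫ f = k ≫ e) :
    ∃ l : ↥(a.generated u) ⟶ D, (sub (isClosed_generated u)).IsHom d l ∧
      ∀ x, l ⟨u x, mem_generated u x⟩ = k x := by
  have h : ∀ x : ↥(a.generated u), ∃ y, e y = f x.1 := fun x =>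
    generated_subset (f := u) (Z := {x | ∃ y, e y = f x}) (fun x => ⟨k x, (ConcreteCategory.congr_hom hk x).symm⟩)
      (hf.isClosed_preimage_range he) x.2
  choose l hl using h
  have hle : ↾l ≫ e = ↾Subtype.val ≫ f := by
    ext x
    exact hl x
  refine ⟨↾l, he.eq_of_injective hinj (hle ▸ (isHom_val _).comp hf), fun x => hinj ?_⟩
  exact (hl _).trans (ConcreteCategory.congr_hom hk x)

end Bialgebra

end CategoryTheory

/-! ### Resolving an algebra on carriers of prescribed size -/

namespace CategoryTheory

open Cardinal

theorem MonadHom.isConsistent_of_target {S S' : Monad (Type u)} {i : S ⟶ S'}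
    (hS' : S'.IsConsistent) : S.IsConsistent := fun X x y h => by
  refine hS' X ?_
  have e := ConcreteCategory.congr_hom (MonadHom.unit_app i X)
  exact (e x).symm.trans ((congrArg _ h).trans (e y))

theorem Monad.two_le_mk {S : Monad (Type u)} (hS : S.IsConsistent) (B : Type u) :
    2 ≤ #(S.obj (B ⊕ ULift.{u} Bool)) := by
  rw [two_le_iff]
  refine ⟨S.unit _ (.inr ⟨false⟩), S.unit _ (.inr ⟨true⟩), fun h => ?_⟩
  have h' := hS _ h
  simp at h'

theorem Monad.map_inl_app_injective {S S' : Monad (Type u)} {i : S ⟶ S'}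
    (hi : MonadHom.IsInjective i) {B : Type u} {a : S.obj B ⟶ B} (V : Type u) :
    Function.Injective (i.app B ≫ S'.map (↾(Sum.inl : B → B ⊕ V))) := by
  intro x y hxy
  apply hi
  -- A retraction of `Sum.inl` needs a point of `B`; `a x` supplies one, so `B` empty needs no
  -- separate case.
  let r : B ⊕ V ⟶ B := ↾Sum.elim _root_.id fun _ => a x
  have hr : ↾(Sum.inl : B → B ⊕ V) ≫ r = 𝟙 B := rfl
  have h := congrArg (S'.map r) hxy
  simp only [types_comp_apply, ← Functor.map_comp_apply, hr] at h
  simpa using h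

theorem mk_fun_eq_two_power {ν V : Type u} (hν : ℵ₀ ≤ #ν) (hV : 2 ≤ #V) (hV' : #V ≤ #ν) :
    #(ν → V) = 2 ^ #ν := by
  rw [← power_def, power_eq_two_power hν hV hV']

/-- Extend an injective monad morphism to a large algebra over `a` whose fibres all have the same
cardinality, embedded in an algebra with a complement of that cardinality. -/
theorem Monad.exists_algebra_embedding {S S' : Monad (Type u)} {i : S ⟶ S'}
    (hi : MonadHom.IsInjective i) (hS' : S'.IsConsistent) {B : Type u} {a : S.obj B ⟶ B}
    (ha : S.IsAlgebra a) {ν : Type u} (hν : ℵ₀ ≤ #ν)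
    (hν' : #(S'.obj (B ⊕ ULift.{u} Bool)) ≤ #ν) :
    ∃ (D E : Type u) (d : S.obj D ⟶ D) (c : S'.obj E ⟶ E) (q : D ⟶ B) (e : D ⟶ E),
      S.IsAlgebra d ∧ S'.IsAlgebra c ∧ S.map q ≫ a = d ≫ q ∧
      S.map e ≫ i.app E ≫ c = d ≫ e ∧ Function.Injective e ∧
      (∀ y, #{x // q x = y} = 2 ^ #ν) ∧ #↥(Set.range e)ᶜ = 2 ^ #ν := by
  -- The two extra points, with consistency, give `S.obj W` and `S'.obj W` at least two elements, so
  -- their `ν`-th powers have size `2 ^ #ν`.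
  let W : Type u := B ⊕ ULift.{u} Bool
  let u : S.obj B ⟶ S'.obj W := i.app B ≫ S'.map (↾Sum.inl)
  have hu : Function.Injective u := map_inl_app_injective (a := a) hi _
  have hSW : #(S.obj W) ≤ #ν := (mk_le_of_injective (hi W)).trans hν'
  have hSB : #(S.obj B) ≤ #ν := (mk_le_of_injective hu).trans hν'
  have hDpow : #(ν → S.obj W) = 2 ^ #ν :=
    mk_fun_eq_two_power hν (two_le_mk (MonadHom.isConsistent_of_target (i := i) hS') B) hSW
  let π₁ : S.obj B × (ν → S.obj W) ⟶ S.obj B := ↾_root_.Prod.fst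
  let π₂ (n : ν) : S.obj B × (ν → S.obj W) ⟶ S.obj W := ↾fun x => x.2 n
  let ρ (k : Option (ν ⊕ ν)) : (Option (ν ⊕ ν) → S'.obj W) ⟶ S'.obj W := ↾fun x => x k
  let d : S.obj (S.obj B × (ν → S.obj W)) ⟶ S.obj B × (ν → S.obj W) :=
    ↾fun s => (S.mul B (S.map π₁ s), fun n => S.mul W (S.map (π₂ n) s))
  let c : S'.obj (Option (ν ⊕ ν) → S'.obj W) ⟶ (Option (ν ⊕ ν) → S'.obj W) :=
    ↾fun s k => S'.mul W (S'.map (ρ k) s)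
  -- Each `ν`-coordinate is recorded twice, so every tuple whose two copies differ lies outside the
  -- range.
  let e : S.obj B × (ν → S.obj W) ⟶ (Option (ν ⊕ ν) → S'.obj W) :=
    ↾fun x k => k.elim (u x.1) (Sum.elim (fun n => i.app W (x.2 n)) fun n => i.app W (x.2 n))
  refine ⟨_, _, d, c, π₁ ≫ a, e, ?_, ?_, ?_, ?_, ?_, ?_, ?_⟩
  · refine .of_jointly_monic (ι := Option ν)
      (A := fun k => S.obj (k.elim B fun _ => W)) (a := fun k => S.mul _)
      (fun k => S.isAlgebra_mul _)
      (π := fun k => match k with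
        | none => π₁
        | some n => π₂ n) ?_ ?_
    · intro Z f g h
      have h₁ : f ≫ π₁ = g ≫ π₁ := h none
      have h₂ (n : ν) : f ≫ π₂ n = g ≫ π₂ n := h (some n)
      refine ConcreteCategory.hom_ext f g fun (z : Z) => ?_
      have h₃ : (f z).1 = (g z).1 := types_congr_hom h₁ z
      have h₄ (n : ν) : (f z).2 n = (g z).2 n := types_congr_hom (h₂ n) z
      exact _root_.Prod.ext h₃ (funext h₄)
    · rintro (_ | n) <;> rfl
  · refine .of_jointly_monic (a := fun _ => S'.mul W) (fun _ => S'.isAlgebra_mul _) (π := ρ)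
      ?_ fun _ => rfl
    intro Z f g h
    exact ConcreteCategory.hom_ext _ _ fun z =>
      funext fun k => ConcreteCategory.congr_hom (h k) z
  · rw [Functor.map_comp, Category.assoc, ← ha.mul]
    rfl
  · have h₁ : S.map (e ≫ ρ none) ≫ i.app _ ≫ S'.mul W = d ≫ e ≫ ρ none := by
      change S.map (π₁ ≫ u) ≫ i.app _ ≫ S'.mul W = (S.map π₁ ≫ S.mul B) ≫ u
      rw [Functor.map_comp, Category.assoc, Category.assoc, MonadHom.mul_app_assoc, S'.mul_map,
        Functor.map_comp, Category.assoc, MonadHom.map_app_assoc i (S'.map _)]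
    have h₂ (n : ν) : S.map (π₂ n ≫ i.app W) ≫ i.app _ ≫ S'.mul W =
        (S.map (π₂ n) ≫ S.mul W) ≫ i.app W := by
      rw [Functor.map_comp, Category.assoc, Category.assoc, MonadHom.mul_app]
    have h (k) : S.map (e ≫ ρ k) ≫ i.app _ ≫ S'.mul W = d ≫ e ≫ ρ k := by
      rcases k with _ | n | n
      exacts [h₁, h₂ n, h₂ n]
    refine ConcreteCategory.hom_ext _ _ fun s => funext fun k => ?_
    refine Eq.trans ?_ (ConcreteCategory.congr_hom (h k) s)
    rw [Functor.map_comp, Category.assoc, MonadHom.map_app_assoc i (ρ k)]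
    rfl
  · intro x y h
    refine _root_.Prod.ext (hu (congrFun h none)) (funext fun n => hi W (congrFun h (some (.inl n))))
  · intro y
    apply le_antisymm
    · refine (mk_subtype_le _).trans ?_
      rw [mk_prod, lift_id, lift_id, hDpow]
      refine (mul_le_max_of_aleph0_le_right (hν.trans (cantor _).le)).trans ?_
      exact max_le (hSB.trans (cantor _).le) le_rfl
    -- The fibre over `y` contains `S.unit B y` paired with any element of the power.
    · rw [← hDpow]
      refine mk_le_of_injective (f := fun f => ⟨(S.unit B y, f), ?_⟩) fun f g h => ?_
      · exact ConcreteCategory.congr_hom ha.unit y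
      · exact congrArg (fun x => x.1.2) h
  · have hS₂ := two_le_mk hS' B
    apply le_antisymm
    · refine (mk_subtype_le _).trans ?_
      have hidx : #(Option (ν ⊕ ν)) = #ν := by
        rw [mk_option, mk_sum, lift_id, add_eq_self hν, add_one_eq hν]
      rw [← hidx, mk_fun_eq_two_power (hidx ▸ hν) hS₂ (hidx ▸ hν')]
    · rw [← mk_fun_eq_two_power hν hS₂ hν']
      obtain ⟨w₀, w₁, hw⟩ := two_le_iff.1 hS₂
      classical
      have : Nonempty ν := by
        rw [← mk_ne_zero_iff]
        exact (aleph0_pos.trans_le hν).ne'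
      -- The second copy is chosen to differ from `f` at each index; `ν` being nonempty, the tuple
      -- misses the range of `e`.
      refine mk_le_of_injective (f := fun f => ⟨fun k => k.elim w₀
        (Sum.elim f fun n => if f n = w₀ then w₁ else w₀), ?_⟩) fun f g h => ?_
      · rintro ⟨x, hx⟩
        obtain ⟨n⟩ := ‹Nonempty ν›
        have h₁ : i.app W (x.2 n) = f n := congrFun hx (some (.inl n))
        have h₂ : i.app W (x.2 n) = if f n = w₀ then w₁ else w₀ := congrFun hx (some (.inr n))
        rw [h₁] at h₂
        split_ifs at h₂ with h₃
        · exact hw (h₃.symm.trans h₂)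
        · exact h₃ h₂
      · funext n
        exact congrFun (congrArg Subtype.val h) (some (.inl n))

theorem exists_equiv_prod_of_fibers {D B K : Type u} (q : D → B)
    (hq : ∀ y, #{x // q x = y} = #K) : ∃ e : D ≃ B × K, ∀ x, (e x).1 = q x := by
  have f := fun y => Cardinal.eq.1 (hq y)
  exact ⟨(Equiv.sigmaFiberEquiv q).symm.trans
    ((Equiv.sigmaCongrRight fun y => (f y).some).trans (Equiv.sigmaEquivProd B K)), fun _ => rfl⟩

theorem exists_equiv_sum_of_injective {D E K : Type u} {e : D → E} (he : Function.Injective e)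
    (hK : #↥(Set.range e)ᶜ = #K) : ∃ f : E ≃ D ⊕ K, ∀ x, f (e x) = .inl x := by
  classical
  obtain ⟨g⟩ := Cardinal.eq.1 hK
  refine ⟨((Equiv.sumCongr (Equiv.ofInjective e he) g.symm).trans
    (Equiv.Set.sumCompl (Set.range e))).symm, fun x => ?_⟩
  rw [Equiv.symm_apply_eq]
  simp

/-- Equal fibres and a complement of the same size let the embedding be transported to carriers that
depend only on `B` and `K`, not on the monad. -/
theorem Monad.exists_algebra_prod_sum {S S' : Monad (Type u)} {i : S ⟶ S'}
    (hi : MonadHom.IsInjective i) (hS' : S'.IsConsistent) {B : Type u} {a : S.obj B ⟶ B}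
    (ha : S.IsAlgebra a) {ν : Type u} (hν : ℵ₀ ≤ #ν)
    (hν' : #(S'.obj (B ⊕ ULift.{u} Bool)) ≤ #ν) {K : Type u} (hK : #K = 2 ^ #ν) :
    ∃ (d : S.obj (B × K) ⟶ B × K) (c : S'.obj ((B × K) ⊕ K) ⟶ (B × K) ⊕ K),
      S.IsAlgebra d ∧ S'.IsAlgebra c ∧ S.map (↾_root_.Prod.fst) ≫ a = d ≫ ↾_root_.Prod.fst ∧
      S.map (↾Sum.inl) ≫ i.app _ ≫ c = d ≫ ↾Sum.inl := by
  obtain ⟨D, E, d, c, q, e, hd, hc, hq, he, he', hqK, heK⟩ :=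
    exists_algebra_embedding hi hS' ha hν hν'
  obtain ⟨f, hf⟩ := exists_equiv_prod_of_fibers (K := K) q fun y => (hqK y).trans hK.symm
  obtain ⟨g, hg⟩ := exists_equiv_sum_of_injective (K := K) he' (heK.trans hK.symm)
  let φ : D ≅ B × K := f.toIso
  let ψ : E ≅ (B × K) ⊕ K := (g.trans (f.sumCongr (Equiv.refl K))).toIso
  have hφ : φ.hom ≫ ↾_root_.Prod.fst = q := by
    ext x
    exact hf x
  have hψ : e ≫ ψ.hom = φ.hom ≫ ↾Sum.inl := by
    ext x
    exact congrArg (f.sumCongr (Equiv.refl K)) (hg x)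
  have hφ' : φ.inv ≫ q = ↾_root_.Prod.fst := by rw [← hφ, φ.inv_hom_id_assoc]
  have hψ' : ↾Sum.inl ≫ ψ.inv = φ.inv ≫ e := by
    rw [← cancel_mono ψ.hom, Category.assoc, Category.assoc, hψ, ψ.inv_hom_id,
      φ.inv_hom_id_assoc, Category.comp_id]
  refine ⟨S.map φ.inv ≫ d ≫ φ.hom, S'.map ψ.inv ≫ c ≫ ψ.hom, hd.transport φ, hc.transport ψ,
    ?_, ?_⟩
  · rw [Category.assoc, Category.assoc, hφ, ← hq, ← hφ', Functor.map_comp, Category.assoc]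
  · rw [← MonadHom.map_app_assoc, ← Functor.map_comp_assoc, hψ', Functor.map_comp,
      Category.assoc, reassoc_of% he, hψ, Category.assoc, Category.assoc]

/-! ### Free bialgebras inside the larger coproduct -/

namespace Bialgebra

variable {S T S' T' : Monad (Type u)} {i : S ⟶ S'} {j : T ⟶ T'}

theorem exists_resolution (hS' : S'.IsConsistent) (hT' : T'.IsConsistent)
    (hi : MonadHom.IsInjective i) (hj : MonadHom.IsInjective j) {B : Type u}
    (b : Bialgebra S T B) :
    ∃ (D E : Type u) (d : Bialgebra S T D) (c : Bialgebra S' T' E) (q : D ⟶ B) (e : D ⟶ E),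
      d.IsHom b q ∧ d.IsHom (c.restrict i j) e ∧ Function.Surjective q ∧
      Function.Injective e := by
  -- A single infinite `ν` bounding the data of both monads, so that both use the same `K`.
  let ν : Type u := ULift.{u} ℕ ⊕ S'.obj (B ⊕ ULift.{u} Bool) ⊕ T'.obj (B ⊕ ULift.{u} Bool)
  have hν : ℵ₀ ≤ #ν := by
    rw [← infinite_iff]
    infer_instance
  obtain ⟨d₁, c₁, hd₁, hc₁, hq₁, he₁⟩ := Monad.exists_algebra_prod_sum (K := ν → Prop) hi hS'
    b.isAlgebra_left hν
    (mk_le_of_injective (f := Sum.inr ∘ Sum.inl) (Sum.inr_injective.comp Sum.inl_injective))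
    (by simp)
  obtain ⟨d₂, c₂, hd₂, hc₂, hq₂, he₂⟩ := Monad.exists_algebra_prod_sum (K := ν → Prop) hj hT'
    b.isAlgebra_right hν
    (mk_le_of_injective (f := Sum.inr ∘ Sum.inr) (Sum.inr_injective.comp Sum.inr_injective))
    (by simp)
  exact ⟨_, _, ⟨d₁, d₂, hd₁, hd₂⟩, ⟨c₁, c₂, hc₁, hc₂⟩, ↾_root_.Prod.fst, ↾Sum.inl, ⟨hq₁, hq₂⟩,
    ⟨he₁, he₂⟩, fun y => ⟨(y, fun _ => True), rfl⟩, Sum.inl_injective⟩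

variable (i j) [HasBinaryCoproduct S' T']

/-- The bialgebra on the coproduct of the larger monads, for the smaller monads. -/
noncomputable abbrev coprodRestrict (X : Type u) : Bialgebra S T ((S' ⨿ T').obj X) :=
  (ofCospan coprod.inl coprod.inr X).restrict i j

theorem exists_lift_coprodRestrict (hS' : S'.IsConsistent) (hT' : T'.IsConsistent)
    (hi : MonadHom.IsInjective i) (hj : MonadHom.IsInjective j) {X B : Type u}
    (b : Bialgebra S T B) (f : X ⟶ B) :
    ∃ l : ↥((coprodRestrict i j X).generated ((S' ⨿ T').unit X)) ⟶ B,
      (sub (isClosed_generated ((S' ⨿ T').unit X))).IsHom b l ∧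
      ∀ x, l ⟨(S' ⨿ T').unit X x, mem_generated _ x⟩ = f x := by
  obtain ⟨D, E, d, c, q, e, hq, he, hqs, hei⟩ := exists_resolution hS' hT' hi hj b
  choose k hk using fun x => hqs (f x)
  obtain ⟨h, hh, hu⟩ := exists_isHom_coprod c (↾k ≫ e)
  obtain ⟨l, hl, hl'⟩ := exists_lift_generated (hh.restrict i j) he hei hu
  exact ⟨l ≫ q, hl.comp hq, fun x => (congrArg q (hl' x)).trans (hk x)⟩

end Bialgebra

/-- The free bialgebras for submonads of two monads with a coproduct. -/
noncomputable def freeBialgebrasOfInjective {S T S' T' : Monad (Type u)} {i : S ⟶ S'}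
    {j : T ⟶ T'} [HasBinaryCoproduct S' T'] (hS' : S'.IsConsistent) (hT' : T'.IsConsistent)
    (hi : MonadHom.IsInjective i) (hj : MonadHom.IsInjective j) : FreeBialgebras S T where
  obj X := ↥((Bialgebra.coprodRestrict i j X).generated ((S' ⨿ T').unit X))
  str X := Bialgebra.sub (Bialgebra.isClosed_generated _)
  unit X := ↾fun x => ⟨(S' ⨿ T').unit X x, Bialgebra.mem_generated _ x⟩
  lift a f := (Bialgebra.exists_lift_coprodRestrict i j hS' hT' hi hj a f).choose
  isHom_lift a f := (Bialgebra.exists_lift_coprodRestrict i j hS' hT' hi hj a f).choose_spec.1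
  unit_lift a f := by
    ext x
    exact (Bialgebra.exists_lift_coprodRestrict i j hS' hT' hi hj a f).choose_spec.2 x
  hom_ext hf hg h := Bialgebra.generated_hom_ext hf hg fun x => ConcreteCategory.congr_hom h x

theorem desc_freeBialgebrasOfInjective {S T S' T' : Monad (Type u)} {i : S ⟶ S'}
    {j : T ⟶ T'} [HasBinaryCoproduct S' T'] (hS' : S'.IsConsistent) (hT' : T'.IsConsistent)
    (hi : MonadHom.IsInjective i) (hj : MonadHom.IsInjective j) :
    MonadHom.IsInjective ((freeBialgebrasOfInjective hS' hT' hi hj).desc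
      (i ≫ (coprod.inl : S' ⟶ S' ⨿ T')) (j ≫ coprod.inr)) := by
  intro X
  let F := freeBialgebrasOfInjective hS' hT' hi hj
  -- The chosen lift is not explicit; uniqueness identifies it with the inclusion, which agrees with
  -- it on generators.
  have h : (F.desc (i ≫ (coprod.inl : S' ⟶ S' ⨿ T')) (j ≫ coprod.inr)).app X =
      ↾Subtype.val :=
    F.hom_ext (a := .ofCospan (i ≫ (coprod.inl : S' ⟶ S' ⨿ T')) (j ≫ coprod.inr) X)
      (F.isHom_lift _ _) (Bialgebra.isHom_val (Bialgebra.isClosed_generated _))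
      (F.unit_lift _ _)
  rw [h]
  exact Subtype.val_injective

theorem MonadHom.IsInjective.iso_comp {R S T : Monad (Type u)} (φ : R ≅ S) {f : S ⟶ T}
    (hf : MonadHom.IsInjective f) : MonadHom.IsInjective (φ.hom ≫ f) := by
  intro X x y h
  have e : φ.hom.app X ≫ φ.inv.app X = 𝟙 (R.obj X) :=
    congrArg (fun g : R ⟶ R => g.app X) φ.hom_inv_id
  have h' := congrArg (φ.inv.app X) (hf X (a₁ := φ.hom.app X x) (a₂ := φ.hom.app X y) h)
  rwa [← types_comp_apply, ← types_comp_apply, e] at h'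

end CategoryTheory

theorem mainTheorem4 (S T S' T' : Monad (Type u))
    (hS' : S'.IsConsistent) (hT' : T'.IsConsistent)
    [HasBinaryCoproduct S' T']
    (i : S ⟶ S') (j : T ⟶ T')
    (hi : MonadHom.IsInjective i) (hj : MonadHom.IsInjective j) :
    ∃ _ : HasBinaryCoproduct S T, MonadHom.IsInjective (coprod.map i j) := by
  let F := freeBialgebrasOfInjective hS' hT' hi hj
  have inst := F.hasBinaryCoproduct
  refine ⟨inst, ?_⟩
  let φ : S ⨿ T ≅ F.monad := (coprodIsCoprod S T).coconePointUniqueUpToIso F.isColimit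
  have h : coprod.map i j = φ.hom ≫ F.desc (i ≫ coprod.inl) (j ≫ coprod.inr) := by
    apply coprod.hom_ext
    · rw [coprod.inl_map]
      have := (coprodIsCoprod S T).comp_coconePointUniqueUpToIso_hom F.isColimit ⟨.left⟩
      exact (F.inl_desc _ _).symm.trans (by rw [← Category.assoc]; exact congrArg (· ≫ _) this.symm)
    · rw [coprod.inr_map]
      have := (coprodIsCoprod S T).comp_coconePointUniqueUpToIso_hom F.isColimit ⟨.right⟩
      exact (F.inr_desc _ _).symm.trans (by rw [← Category.assoc]; exact congrArg (· ≫ _) this.symm)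
  rw [h]
  exact (desc_freeBialgebrasOfInjective hS' hT' hi hj).iso_comp φ
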